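/- Let $n,d$ be positive integers with $d\ge 625$, let $C$ be a class of Boolean functions $\{0,1\}^n\to\{0,1\}$ of VC dimension $d+1$, let $\delta=1/5$ and let $0<\epsilon<1/32$. For a function $c:\{0,1\}^n\to\{0,1\}$ and a probability distribution $\mathcal D$ on $\{0,1\}^n$, the quantum example oracle $QEX(c,\mathcal D)$ is a gate on $n+1$ qubits with $$|0^n,0\rangle\mapsto\sum_{x\in\{0,1\}^n}\sqrt{\mathcal D(x)}\,|x,c(x)\rangle ,$$ which may be invoked only when these qubits are in the state $|0^n,0\rangle$. A quantum $(\epsilon,\delta)$-PAC learning algorithm for $C$ with sample complexity $T$ is a quantum circuit on finitely many qubits, started in $|0\ldots0\rangle$, consisting of fixed unitary transformations and $T$ invocations of $QEX(c,\mathcal D)$, followed by a measurement in the computational basis whose outcome is read as a hypothesis $h:\{0,1\}^n\to\{0,1\}$, such that for every $c\in C$ and every probability distribution $\mathcal D$ on $\{0,1\}^n$, with probability at least $1-\delta$ one has $\Pr_{x\sim\mathcal D}[h(x)\ne c(x)]\le\epsilon$. Then every quantum $(\epsilon,\delta)$-PAC learning algorithm for $C$ has sample complexity $$T\ \ge\ \frac{\sqrt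 d}{10000\,\epsilon}.$$ -/

import Mathlib

namespace QPAC

/-- The input space `{0,1}^n`. -/
abbrev Cube (n : ℕ) : Type := Fin n → Bool

/-- A concept over `{0,1}^n`: a Boolean function `{0,1}^n → {0,1}`. -/
abbrev Concept (n : ℕ) : Type := Cube n → Bool

/-- The subset `{x : c(x) = 1}` of `{0,1}^n` corresponding to the concept `c`. -/
def Concept.toFinset {n : ℕ} (c : Concept n) : Finset (Cube n) :=
  Finset.univ.filter (fun x => c x = true)

/-- The Vapnik-Chervonenkis dimension of a class of concepts over `{0,1}^n`: the largest size of
a set of inputs that is shattered by the class. -/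
def vcDimension {n : ℕ} (C : Finset (Concept n)) : ℕ :=
  (C.image Concept.toFinset).vcDim

/-- Probability distributions on `{0,1}^n`, as nonnegative weight functions of total mass one. -/
abbrev Distribution (n : ℕ) : Type := stdSimplex ℝ (Cube n)

/-- The error `Pr_{x ∼ D}[h(x) ≠ c(x)]` of the hypothesis `h` for the target `c`. -/
def error {n : ℕ} (D : Distribution n) (h c : Concept n) : ℝ :=
  ∑ x ∈ Finset.univ.filter (fun x => h x ≠ c x), (D : Cube n → ℝ) x

/-- Computational basis states `|x, b, w⟩` of a register of `n + 1 + m` qubits: `(x, b)` is the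
content of the `n + 1` example qubits and `w` that of the `m` work qubits. -/
abbrev BasisState (n m : ℕ) : Type := (Cube n × Bool) × (Fin m → Bool)

/-- The state space of `n + 1 + m` qubits. -/
abbrev QState (n m : ℕ) : Type := EuclideanSpace ℂ (BasisState n m)

/-- The content `|0^n, 0⟩` of the example qubits. -/
def zeroExample (n : ℕ) : Cube n × Bool := (fun _ => false, false)

/-- The amplitudes of `∑_x √D(x) |x, c(x)⟩`. -/
noncomputable def exampleAmplitude {n : ℕ} (c : Concept n) (D : Distribution n)
    (p : Cube n × Bool) : ℂ :=
  if p.2 = c p.1 then ((Real.sqrt ((D : Cube n → ℝ) p.1) : ℝ) : ℂ) else 0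

/-- The example qubits are in the state `|0^n, 0⟩`, that is, `s = |0^n, 0⟩ ⊗ φ` for some `φ`. -/
def ExampleQubitsZero {n m : ℕ} (s : QState n m) : Prop :=
  ∀ (p : Cube n × Bool) (w : Fin m → Bool), p ≠ zeroExample n → s (p, w) = 0

/-- The gate `QEX(c, D)` applied to the example qubits:
`|0^n, 0⟩ ⊗ φ ↦ (∑_x √D(x) |x, c(x)⟩) ⊗ φ`.
It may only be invoked on states of this form (see `Algorithm.CallsAllowed`); the values of this
function on other states are meaningless. -/
noncomputable def applyQEX {n m : ℕ} (c : Concept n) (D : Distribution n) (s : QState n m) :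
    QState n m :=
  WithLp.toLp 2 (fun q => exampleAmplitude c D q.1 * s (zeroExample n, q.2))

/-- A quantum algorithm with access to a quantum example oracle: the circuit
`U 0, QEX, U 1, QEX, …, QEX, U calls` on `n + 1 + workQubits` qubits, with fixed unitary
transformations `U i`, started in `|0…0⟩`. At the end all qubits are measured in the
computational basis, and the outcome is read as a hypothesis through the fixed map `hypothesis`.
(Only `U 0, …, U calls` matter.) -/
structure Algorithm (n : ℕ) where
  workQubits : ℕ
  calls : ℕ
  U : ℕ → (QState n workQubits ≃ₗᵢ[ℂ] QState n workQubits)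
  hypothesis : BasisState n workQubits → Concept n

namespace Algorithm

variable {n : ℕ}

/-- The number of invocations of `QEX`. -/
def sampleComplexity (A : Algorithm n) : ℕ := A.calls

/-- The state right after `U t` has been applied, when the oracle is `QEX(c, D)`. -/
noncomputable def state (A : Algorithm n) (c : Concept n) (D : Distribution n) :
    ℕ → QState n A.workQubits
  | 0 => A.U 0 (EuclideanSpace.single (zeroExample n, fun _ => false) 1)
  | t + 1 => A.U (t + 1) (applyQEX c D (A.state c D t))

/-- With the oracle `QEX(c, D)`, every call is made with the example qubits in `|0^n, 0⟩`. -/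
def CallsAllowed (A : Algorithm n) (c : Concept n) (D : Distribution n) : Prop :=
  ∀ t < A.calls, ExampleQubitsZero (A.state c D t)

open Classical in
/-- The probability that, with the oracle `QEX(c, D)`, the measured hypothesis `h` satisfies
`Pr_{x ∼ D}[h(x) ≠ c(x)] ≤ ε`. -/
noncomputable def successProbability (A : Algorithm n) (c : Concept n) (D : Distribution n)
    (ε : ℝ) : ℝ :=
  ∑ q ∈ Finset.univ.filter (fun q => error D (A.hypothesis q) c ≤ ε),
    ‖A.state c D A.calls q‖ ^ 2

/-- `A` is a quantum `(ε, δ)`-PAC learning algorithm for `C`: for every target `c ∈ C` and every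
distribution `D`, it calls `QEX(c, D)` only on `|0^n, 0⟩` and outputs, with probability at least
`1 - δ`, a hypothesis of error at most `ε`. -/
def PACLearns (A : Algorithm n) (C : Finset (Concept n)) (ε δ : ℝ) : Prop :=
  ∀ c ∈ C, ∀ D : Distribution n,
    A.CallsAllowed c D ∧ 1 - δ ≤ A.successProbability c D ε

end Algorithm

end QPAC

/-!
The argument is a quantum form of Assouad's lemma.

Since the oracle may be called only on `|0^n, 0⟩`, a call is an isometry that tensors the state of
the work qubits with `|ψ_c⟩ = ∑ₓ √D(x) |x, c(x)⟩`. Two runs of the same algorithm, with targets `c`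
and `c'`, therefore have inner product exactly `⟨ψ_c, ψ_c'⟩ ^ t = (1 - Pr_D[c ≠ c']) ^ t` after `t`
calls (`inner_state`).

Take a shattered set `{x₀} ∪ X` with `|X| = d`, and let `D` put mass `32 ε / d` on every point of
`X` and the remaining mass on `x₀`. For each labelling `b` of `X` choose a target `c_b ∈ C` that
agrees with `b` on `X` and vanishes at `x₀`.

* If `b` and `b'` differ at the single point `x`, the final states have overlap
  `F = (1 - 32 ε / d) ^ T`, and no measurement distinguishes them well: the probabilities of
  predicting the label of `x` wrongly add up to at least `F² / 2`
  (`sq_overlap_le_two_mul_add`). Averaging over `b`, every point of `X` is mislabelled with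
  probability at least `F² / 4`.
* A learner with confidence `4/5` mislabels, on average, at most a fraction
  `4/5 · 1/32 + 1/5 = 9/40` of `X` (`sum_mislabelProb_le`).

Hence `F² ≤ 9/10`, which by Bernoulli's inequality fails unless `T ≥ d / (640 ε)`; for `d ≥ 625`
this is more than `√d / (10000 ε)`.
-/

namespace QPAC

/-! ### Overlap of two runs of a circuit -/

section Overlap

variable {n m : ℕ}

theorem error_self (D : Distribution n) (c : Concept n) : error D c c = 0 := by
  simp [error]

theorem sum_conj_exampleAmplitude_mul (c c' : Concept n) (D : Distribution n) :
    ∑ p, exampleAmplitude c' D p * (starRingEnd ℂ) (exampleAmplitude c D p)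
      = ((1 - error D c c' : ℝ) : ℂ) := by
  have hD : ∑ x, (D : Cube n → ℝ) x = 1 := stdSimplex.sum_eq_one D
  have h1 : (1 : ℝ) - error D c c'
      = ∑ x, if c x = c' x then (D : Cube n → ℝ) x else 0 := by
    rw [← hD, error, ← Finset.sum_filter,
      ← Finset.sum_filter_add_sum_filter_not Finset.univ (fun x => c x = c' x)]
    simp
  rw [h1, Fintype.sum_prod_type]
  push_cast
  refine Finset.sum_congr rfl fun x _ => ?_
  have hs : ((Real.sqrt ((D : Cube n → ℝ) x) : ℝ) : ℂ) * (Real.sqrt ((D : Cube n → ℝ) x) : ℝ)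
      = (((D : Cube n → ℝ) x : ℝ) : ℂ) := by
    rw [← Complex.ofReal_mul, Real.mul_self_sqrt (stdSimplex.zero_le D x)]
  rw [Fintype.sum_bool]
  cases hc : c x <;> cases hc' : c' x <;> simp [exampleAmplitude, hc, hc', hs]

theorem inner_eq_sum_of_exampleQubitsZero {s s' : QState n m} (hs : ExampleQubitsZero s) :
    inner ℂ s s'
      = ∑ w, s' (zeroExample n, w) * (starRingEnd ℂ) (s (zeroExample n, w)) := by
  rw [PiLp.inner_apply, Fintype.sum_prod_type, Finset.sum_eq_single (zeroExample n)]
  · simp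
  · intro p _ hp
    exact Finset.sum_eq_zero fun w _ => by simp [hs p w hp]
  · simp

/-- A permitted call of `QEX` multiplies the overlap of two states by `⟨ψ_c, ψ_c'⟩`. -/
theorem inner_applyQEX (c c' : Concept n) (D : Distribution n) {s s' : QState n m}
    (hs : ExampleQubitsZero s) :
    inner ℂ (applyQEX c D s) (applyQEX c' D s')
      = ((1 - error D c c' : ℝ) : ℂ) * inner ℂ s s' := by
  rw [inner_eq_sum_of_exampleQubitsZero hs, ← sum_conj_exampleAmplitude_mul,
    Finset.sum_mul_sum, PiLp.inner_apply, Fintype.sum_prod_type]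
  refine Finset.sum_congr rfl fun p _ => Finset.sum_congr rfl fun w _ => ?_
  simp only [applyQEX, RCLike.inner_apply, map_mul]
  ring

theorem inner_state (A : Algorithm n) (c c' : Concept n) (D : Distribution n)
    (hc : A.CallsAllowed c D) {t : ℕ} (ht : t ≤ A.calls) :
    inner ℂ (A.state c D t) (A.state c' D t) = (((1 - error D c c') ^ t : ℝ) : ℂ) := by
  induction t with
  | zero => simp [Algorithm.state]
  | succ t ih =>
    simp only [Algorithm.state, LinearIsometryEquiv.inner_map_map]
    rw [inner_applyQEX c c' D (hc t ht), ih (by omega), pow_succ]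
    push_cast
    ring

theorem sum_norm_sq_state (A : Algorithm n) (c : Concept n) (D : Distribution n)
    (hc : A.CallsAllowed c D) : ∑ q, ‖A.state c D A.calls q‖ ^ 2 = 1 := by
  have h := inner_state A c c D hc le_rfl
  rw [error_self, sub_zero, one_pow] at h
  rw [← EuclideanSpace.norm_sq_eq, ← inner_self_eq_norm_sq (𝕜 := ℂ), h]
  simp

end Overlap

/-! ### Indistinguishability of nearby states -/

/-- States of large overlap are hard to tell apart: when the outcomes outside `S` are read as a
guess of `u` and those in `S` as a guess of `v`, the two error probabilities add up to at least
`|⟨u, v⟩|² / 2`. -/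
theorem sq_overlap_le_two_mul_add {ι : Type*} [Fintype ι] (S : ι → Prop) [DecidablePred S]
    (u v : EuclideanSpace ℂ ι) (hu : ∑ q, ‖u q‖ ^ 2 = 1) (hv : ∑ q, ‖v q‖ ^ 2 = 1) :
    ‖inner ℂ u v‖ ^ 2 ≤ 2 * (∑ q with S q, ‖u q‖ ^ 2 + ∑ q with ¬ S q, ‖v q‖ ^ 2) := by
  have hu' := Finset.sum_filter_add_sum_filter_not Finset.univ S (fun q => ‖u q‖ ^ 2)
  have hv' := Finset.sum_filter_add_sum_filter_not Finset.univ S (fun q => ‖v q‖ ^ 2)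
  have hF : ‖inner ℂ u v‖
      ≤ ∑ q with S q, ‖u q‖ * ‖v q‖ + ∑ q with ¬ S q, ‖u q‖ * ‖v q‖ := by
    rw [Finset.sum_filter_add_sum_filter_not, PiLp.inner_apply]
    exact (norm_sum_le _ _).trans (Finset.sum_le_sum fun q _ => norm_inner_le_norm _ _)
  have h1 := Finset.sum_mul_sq_le_sq_mul_sq (Finset.univ.filter S)
    (fun q => ‖u q‖) (fun q => ‖v q‖)
  have h2 := Finset.sum_mul_sq_le_sq_mul_sq (Finset.univ.filter fun q => ¬ S q)
    (fun q => ‖u q‖) (fun q => ‖v q‖)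
  have p1 : 0 ≤ ∑ q with S q, ‖u q‖ ^ 2 := by positivity
  have p2 : 0 ≤ ∑ q with ¬ S q, ‖u q‖ ^ 2 := by positivity
  have p3 : 0 ≤ ∑ q with S q, ‖v q‖ ^ 2 := by positivity
  have p4 : 0 ≤ ∑ q with ¬ S q, ‖v q‖ ^ 2 := by positivity
  -- Cauchy–Schwarz on each part; on either part one of the two vectors has norm at most one.
  have h1' := h1.trans (mul_le_of_le_one_right p1 (by linarith))
  have h2' := h2.trans (mul_le_of_le_one_left p4 (by linarith))
  calc ‖inner ℂ u v‖ ^ 2 ≤ _ := pow_le_pow_left₀ (norm_nonneg _) hF 2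
    _ ≤ _ := add_sq_le
    _ ≤ _ := by linarith

/-! ### Mislabelling probabilities -/

/-- The probability that the measured hypothesis gives the point `x` a label other than `c x`. -/
noncomputable def mislabelProb {n : ℕ} (A : Algorithm n) (D : Distribution n) (c : Concept n)
    (x : Cube n) : ℝ :=
  ∑ q with A.hypothesis q x ≠ c x, ‖A.state c D A.calls q‖ ^ 2

/-- If the targets `c` and `c'` disagree at `x`, then a learner mislabels `x` noticeably often for
one of them unless their example states have become nearly orthogonal. -/
theorem pow_le_two_mul_mislabelProb_add {n : ℕ} (A : Algorithm n) (D : Distribution n)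
    {c c' : Concept n} (hc : A.CallsAllowed c D) (hc' : A.CallsAllowed c' D) {x : Cube n}
    (hx : c' x = !c x) :
    ((1 - error D c c') ^ A.calls) ^ 2
      ≤ 2 * (mislabelProb A D c x + mislabelProb A D c' x) := by
  have h := sq_overlap_le_two_mul_add (fun q => A.hypothesis q x ≠ c x)
    (A.state c D A.calls) (A.state c' D A.calls)
    (sum_norm_sq_state A c D hc) (sum_norm_sq_state A c' D hc')
  rw [inner_state A c c' D hc le_rfl, Complex.norm_real, Real.norm_eq_abs, sq_abs] at h
  have hS : ∀ q, ¬ (A.hypothesis q x ≠ c x) ↔ A.hypothesis q x ≠ c' x := by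
    intro q
    rw [hx]
    cases A.hypothesis q x <;> cases c x <;> simp
  simp only [hS] at h
  exact h

/-- If all points of `X` have mass at least `μ`, a hypothesis of error at most `ε` mislabels at
most `ε / μ` of them. -/
theorem mul_card_le_of_error_le {n : ℕ} {D : Distribution n} {X : Finset (Cube n)} {μ ε : ℝ}
    (hμ : ∀ x ∈ X, μ ≤ (D : Cube n → ℝ) x) {h c : Concept n} (he : error D h c ≤ ε) :
    μ * ((X.filter fun x => h x ≠ c x).card : ℝ) ≤ ε := by
  refine le_trans ?_ he
  rw [error, mul_comm, ← nsmul_eq_mul, ← Finset.sum_const]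
  calc ∑ _x ∈ X.filter (fun x => h x ≠ c x), μ
      ≤ ∑ x ∈ X.filter (fun x => h x ≠ c x), (D : Cube n → ℝ) x :=
        Finset.sum_le_sum fun x hx => hμ x (Finset.mem_filter.1 hx).1
    _ ≤ _ := Finset.sum_le_sum_of_subset_of_nonneg
        (Finset.filter_subset_filter _ (Finset.subset_univ X)) fun x _ _ => stdSimplex.zero_le D x

/-- A learner that succeeds with probability `4/5` mislabels at most `9/40` of the points of `X` in
expectation, if a successful hypothesis mislabels at most `1/32` of them. -/
theorem sum_mislabelProb_le {n : ℕ} (A : Algorithm n) {D : Distribution n} {c : Concept n}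
    {X : Finset (Cube n)} {ε : ℝ} (hc : A.CallsAllowed c D)
    (hsucc : 4 / 5 ≤ A.successProbability c D ε)
    (hX : ∀ h : Concept n, error D h c ≤ ε →
      ((X.filter fun x => h x ≠ c x).card : ℝ) ≤ X.card / 32) :
    ∑ x ∈ X, mislabelProb A D c x ≤ 9 / 40 * X.card := by
  classical
  set P : BasisState n A.workQubits → ℝ := fun q => ‖A.state c D A.calls q‖ ^ 2 with hP
  have hswap : ∑ x ∈ X, mislabelProb A D c x
      = ∑ q, P q * ((X.filter fun x => A.hypothesis q x ≠ c x).card : ℝ) := by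
    simp only [mislabelProb, Finset.sum_filter]
    rw [Finset.sum_comm]
    refine Finset.sum_congr rfl fun q _ => ?_
    rw [← Finset.sum_filter, Finset.sum_const, nsmul_eq_mul, mul_comm]
  have hone : ∑ q, P q = 1 := sum_norm_sq_state A c D hc
  have hbound : ∀ q, P q * ((X.filter fun x => A.hypothesis q x ≠ c x).card : ℝ)
      ≤ X.card * P q
        - 31 / 32 * X.card * (if error D (A.hypothesis q) c ≤ ε then P q else 0) := by
    intro q
    have hPq : 0 ≤ P q := by positivity
    split_ifs with hq
    · have := mul_le_mul_of_nonneg_left (hX _ hq) hPq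
      linarith
    · have h1 : ((X.filter fun x => A.hypothesis q x ≠ c x).card : ℝ) ≤ X.card := by
        exact_mod_cast Finset.card_filter_le _ _
      have := mul_le_mul_of_nonneg_left h1 hPq
      linarith
  have hs : A.successProbability c D ε
      = ∑ q, if error D (A.hypothesis q) c ≤ ε then P q else 0 := by
    rw [Algorithm.successProbability, Finset.sum_filter]
  rw [hswap]
  calc _ ≤ ∑ q, (X.card * P q
        - 31 / 32 * X.card * (if error D (A.hypothesis q) c ≤ ε then P q else 0)) :=
        Finset.sum_le_sum fun q _ => hbound q
    _ = X.card - 31 / 32 * X.card * A.successProbability c D ε := by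
        rw [Finset.sum_sub_distrib, ← Finset.mul_sum, ← Finset.mul_sum, hone, ← hs, mul_one]
    _ ≤ _ := by
        have := mul_le_mul_of_nonneg_left hsucc (by positivity : (0 : ℝ) ≤ 31 / 32 * X.card)
        linarith

/-! ### The hard family of targets and the hard distribution -/

/-- A class of VC dimension `d + 1` realizes all labellings of some `d`-point set `X` by concepts
that vanish at a further point `x₀`. -/
theorem exists_labelling_family {n d : ℕ} {C : Finset (Concept n)}
    (hC : vcDimension C = d + 1) :
    ∃ (x₀ : Cube n) (X : Finset (Cube n)) (f : Concept n → Concept n), x₀ ∉ X ∧ X.card = d ∧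
      ∀ b, f b ∈ C ∧ f b x₀ = false ∧ ∀ x ∈ X, f b x = b x := by
  classical
  set 𝒜 := C.image Concept.toFinset
  have hne : 𝒜.shatterer.Nonempty := by
    rw [Finset.nonempty_iff_ne_empty]
    intro h
    simp [vcDimension, Finset.vcDim, 𝒜, h] at hC
  obtain ⟨S, hS, hcard⟩ := Finset.exists_mem_eq_sup _ hne Finset.card
  have hScard : S.card = d + 1 := by rw [← hcard]; exact hC
  obtain ⟨x₀, X, hx₀, rfl, hX⟩ := Finset.card_eq_succ.1 hScard
  rw [Finset.mem_shatterer] at hS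
  have key : ∀ b : Concept n, ∃ c ∈ C, c x₀ = false ∧ ∀ x ∈ X, c x = b x := by
    intro b
    obtain ⟨u, hu, hut⟩ := hS (t := X.filter fun x => b x = true)
      ((Finset.filter_subset _ _).trans (Finset.subset_insert _ _))
    obtain ⟨c, hc, rfl⟩ := Finset.mem_image.1 hu
    have hmem : ∀ x ∈ insert x₀ X, (c x = true ↔ x ∈ X ∧ b x = true) := by
      intro x hx
      have := Finset.ext_iff.1 hut x
      simpa only [Finset.mem_inter, hx, true_and, Concept.toFinset, Finset.mem_filter,
        Finset.mem_univ] using this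
    refine ⟨c, hc, ?_, fun x hx => ?_⟩
    · have := hmem x₀ (Finset.mem_insert_self _ _)
      simpa [hx₀] using this
    · have := hmem x (Finset.mem_insert_of_mem hx)
      rw [Bool.eq_iff_iff]
      simpa [hx] using this
  choose f hf using key
  exact ⟨x₀, X, f, hx₀, hX, hf⟩

/-- Mass `μ` on each point of `X` can be completed to a distribution by a single further point. -/
theorem exists_distribution {n : ℕ} {x₀ : Cube n} {X : Finset (Cube n)} (hx₀ : x₀ ∉ X) {μ : ℝ}
    (hμ : 0 ≤ μ) (hμX : X.card * μ ≤ 1) :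
    ∃ D : Distribution n, (∀ x ∈ X, (D : Cube n → ℝ) x = μ) ∧
      ∀ x, x ≠ x₀ → x ∉ X → (D : Cube n → ℝ) x = 0 := by
  classical
  set w : Cube n → ℝ := fun x => (if x = x₀ then 1 - X.card * μ else 0) + if x ∈ X then μ else 0
    with hw
  have hmem : w ∈ stdSimplex ℝ (Cube n) := by
    refine ⟨fun x => ?_, ?_⟩
    · have : (0 : ℝ) ≤ 1 - X.card * μ := by linarith
      change 0 ≤ (if x = x₀ then 1 - X.card * μ else 0) + if x ∈ X then μ else 0
      positivity
    · rw [hw, Finset.sum_add_distrib]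
      simp [Finset.sum_ite_mem]
  refine ⟨⟨w, hmem⟩, fun x hx => ?_, fun x hx hxX => ?_⟩
  · change w x = μ
    have : x ≠ x₀ := fun h => hx₀ (h ▸ hx)
    simp [hw, this, hx]
  · change w x = 0
    simp [hw, hx, hxX]

theorem error_eq_of_disagree_once {n : ℕ} {x₀ : Cube n} {X : Finset (Cube n)}
    {D : Distribution n} (hD : ∀ x, x ≠ x₀ → x ∉ X → (D : Cube n → ℝ) x = 0)
    {c c' : Concept n} (h₀ : c x₀ = c' x₀) {x : Cube n} (hx : c x ≠ c' x)
    (hX : ∀ y ∈ X, y ≠ x → c y = c' y) :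
    error D c c' = (D : Cube n → ℝ) x := by
  rw [error, Finset.sum_eq_single x]
  · intro y hy hyx
    have hy' : c y ≠ c' y := (Finset.mem_filter.1 hy).2
    exact hD y (fun h => hy' (h ▸ h₀)) fun h => hy' (hX y h hyx)
  · intro h
    exact absurd (Finset.mem_filter.2 ⟨Finset.mem_univ x, hx⟩) h

/-! ### The averaging argument -/

/-- Flipping the label of one point is an involution on labellings, so a lower bound on the sum of
`g` over every pair of labellings that differ at `x` alone gives one on the average of `g`. -/
theorem card_mul_le_two_mul_sum_of_flip {n : ℕ} (x : Cube n) (g : Concept n → ℝ) {a : ℝ}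
    (h : ∀ b, a ≤ g b + g (Function.update b x (!b x))) :
    Fintype.card (Concept n) * a ≤ 2 * ∑ b, g b := by
  have hinv : Function.Involutive fun b : Concept n => Function.update b x (!b x) := by
    intro b
    simp
  have hsum : ∑ b, g (Function.update b x (!b x)) = ∑ b, g b :=
    Equiv.sum_comp hinv.toPerm g
  calc (Fintype.card (Concept n) : ℝ) * a = ∑ _b : Concept n, a := by simp
    _ ≤ ∑ b, (g b + g (Function.update b x (!b x))) := Finset.sum_le_sum fun b _ => h b
    _ = _ := by rw [Finset.sum_add_distrib, hsum]; ring

/-- The final states for targets differing at one of the `d` points still have squared overlap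
at most `9/10`. -/
theorem pow_sq_le_of_pacLearns {n d : ℕ} {C : Finset (Concept n)}
    (hC : vcDimension C = d + 1) (hd : 0 < d) {ε : ℝ} (hε : 0 < ε) (hε' : ε < 1 / 32)
    (A : Algorithm n) (hA : A.PACLearns C ε (1 / 5)) :
    ((1 - 32 * ε / d) ^ A.calls) ^ 2 ≤ 9 / 10 := by
  obtain ⟨x₀, X, f, hx₀, hX, hf⟩ := exists_labelling_family hC
  have hd' : (0 : ℝ) < d := by exact_mod_cast hd
  set μ : ℝ := 32 * ε / d with hμdef
  have hμ : 0 < μ := by positivity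
  have hdμ : (d : ℝ) * μ = 32 * ε := by rw [hμdef]; field_simp
  obtain ⟨D, hDX, hD0⟩ := exists_distribution hx₀ hμ.le (by rw [hX, hdμ]; linarith)
  have hcalls : ∀ b, A.CallsAllowed (f b) D := fun b => (hA _ (hf b).1 D).1
  have hupper : ∀ b, ∑ x ∈ X, mislabelProb A D (f b) x ≤ 9 / 40 * d := by
    intro b
    rw [← hX]
    refine sum_mislabelProb_le A (hcalls b) (le_trans (by norm_num) (hA _ (hf b).1 D).2) ?_
    intro h he
    have h1 := mul_card_le_of_error_le (μ := μ) (fun x hx => (hDX x hx).ge) he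
    rw [hX]
    refine le_of_mul_le_mul_left (h1.trans ?_) hμ
    linarith
  have hlower : ∀ x ∈ X, Fintype.card (Concept n) * (((1 - μ) ^ A.calls) ^ 2 / 2)
      ≤ 2 * ∑ b, mislabelProb A D (f b) x := by
    intro x hx
    refine card_mul_le_two_mul_sum_of_flip x _ fun b => ?_
    set b' := Function.update b x (!b x) with hb'
    have hxx : f b' x = !f b x := by
      rw [(hf b').2.2 x hx, (hf b).2.2 x hx, hb', Function.update_self]
    have herr : error D (f b) (f b') = μ := by
      rw [← hDX x hx]
      refine error_eq_of_disagree_once hD0 ?_ ?_ ?_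
      · rw [(hf b).2.1, (hf b').2.1]
      · rw [hxx]
        cases f b x <;> simp
      · intro y hy hyx
        rw [(hf b).2.2 y hy, (hf b').2.2 y hy, hb', Function.update_of_ne hyx]
    have h1 := pow_le_two_mul_mislabelProb_add A D (hcalls b) (hcalls b') hxx
    rw [herr] at h1
    linarith
  have hN : (0 : ℝ) < Fintype.card (Concept n) := by exact_mod_cast Fintype.card_pos
  have h1 := Finset.sum_le_sum hlower
  rw [Finset.sum_const, nsmul_eq_mul, hX, ← Finset.mul_sum, Finset.sum_comm] at h1
  have h2 := Finset.sum_le_sum (s := Finset.univ) fun b _ => hupper b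
  rw [Finset.sum_const, nsmul_eq_mul, Finset.card_univ] at h2
  have hpos : (0 : ℝ) < d * Fintype.card (Concept n) := by positivity
  refine le_of_mul_le_mul_left ?_ hpos
  linarith

end QPAC

theorem mainTheorem3 (n d : ℕ) (C : Finset (QPAC.Concept n)) (hC : QPAC.vcDimension C = d + 1)
    (hd : 625 ≤ d) (ε : ℝ) (hε : 0 < ε) (hε' : ε < 1 / 32)
    (A : QPAC.Algorithm n) (hA : A.PACLearns C ε (1 / 5)) :
    Real.sqrt d / (10000 * ε) ≤ (A.sampleComplexity : ℝ) := by
  have hF := QPAC.pow_sq_le_of_pacLearns hC (by omega) hε hε' A hA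
  have hd' : (625 : ℝ) ≤ d := by exact_mod_cast hd
  have hd0 : (0 : ℝ) < d := by linarith
  have hμ : 32 * ε / d ≤ 1 := by
    rw [div_le_one hd0]
    linarith
  by_contra! hlt
  rw [QPAC.Algorithm.sampleComplexity, lt_div_iff₀ (by positivity)] at hlt
  have hsq : Real.sqrt d * Real.sqrt d = d := Real.mul_self_sqrt hd0.le
  have hs1 : 1 ≤ Real.sqrt d := Real.one_le_sqrt.2 (by linarith)
  have hsd : Real.sqrt d ≤ d := by nlinarith
  have hbern := one_add_mul_le_pow (a := -(32 * ε / d)) (by linarith) A.calls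
  rw [← sub_eq_add_neg] at hbern
  have hsmall : (A.calls : ℝ) * (32 * ε / d) ≤ 1 / 100 := by
    rw [mul_div_assoc', div_le_iff₀ hd0]
    linarith
  have hbase : (99 / 100 : ℝ) ≤ (1 - 32 * ε / d) ^ A.calls := by linarith
  have := pow_le_pow_left₀ (by norm_num) hbase 2
  norm_num at this
  linarith
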